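/- **Setting.** Let $K$ be a field that is complete with respect to a non-trivial non-Archimedean absolute value $|\cdot|$. Let $X$ be a set and $\mathcal{A}$ an algebra of subsets of $X$ which is separating: for $a\neq b$ in $X$ there is $A\in\mathcal{A}$ with $a\in A$, $b\notin A$. A ($K$-valued) *measure* on $\mathcal{A}$ is a map $\mu:\mathcal{A}\to K$ such that (i) $\mu(A\cup B)=\mu(A)+\mu(B)$ for disjoint $A,B\in\mathcal A$; (ii) $\|A\|_\mu:=\sup\{|\mu(B)| : B\subseteq A,\ B\in\mathcal{A}\}<\infty$ for all $A\in\mathcal A$; (iii) for every nonempty family $\mathcal{F}\subseteq\mathcal{A}$ with $\bigcap\mathcal{F}=\varnothing$ in which the intersection of any two members contains a member, and every $\epsilon>0$, there is $A\in\mathcal{F}$ with $|\mu(A)|<\epsilon$. Put $N_\mu(x)=\inf\{\|A\|_\mu : x\in A\in\mathcal{A}\}$. The extended algebra $\mathcal{A}_\mu$ consists of all $A\subseteq X$ such that for every $\epsilon>0$ there is $B_\epsilon\in\mathcal{A}$ with $N_\mu\le\epsilon$ on $A\,\Delta\,B_\epsilon$; the extended measure is $\mu(A)=\lim_{\epsilon\to0}\mu(B_\epsilon)$.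 The space $X$ carries the topology with base $\mathcal{A}$. Nonstandard extensions ${}^*$ are ultrapowers modulo a fixed ultrafilter $U$ on a set $I$; internal objects are those represented by families indexed by $I$. Assume that the extension is $\kappa$-saturated for some cardinal $\kappa\ge\max(\aleph_0,|\mathcal{A}|)$: every family of at most $\kappa$ internal sets all of whose finite subfamilies have nonempty intersection has nonempty intersection. For a topological space $Z$ the monad of $a\in Z$ is $\operatorname{mon}(a)=\bigcap\{{}^*O : a\in O\subseteq Z,\ O \text{ open}\}$; the points of monads are called nearstandard, and, for Hausdorff $Z$, $\mathrm{st}_Z$ maps $\operatorname{mon}(a)$ to $a$. An *internal measure space* $(\Omega,\mathcal{S},\nu)$ consists of an internal set $\Omega$, an internal covering and separating ring $\mathcal{S}$ of internal subsets of $\Omega$, and an internal finitely additive $\nu:\mathcal{S}\to{}^*K$ for which $\|A\|_\nu$ is a hyperreal number for all $A\in\mathcal S$; let $N_\nu:\Omega\to{}^*\mathbb{R}$ be its (internal) norm function, defined from $\nu$ as $N_\mu$ is from $\mu$. A set $A\subseteq\Omega$ (possibly external) is a *Loeb null set* if $N_\nu$ is infinitesimal on $A$, and it is *Loeb measurable*,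 $A\in\mathcal{S}_L$, if $A\,\Delta\,B$ is a Loeb null set for some $B\in\mathcal{S}$; in this case its Loeb measure is $\nu_L(A)=\mathrm{st}_K(\nu(B))$. **Theorem.** Let $(X,\mathcal{A},\mu)$ be as above and assume that ${}^*\mu(B)\in{}^*K$ is nearstandard for all $B\in{}^*\mathcal{A}$. Then there is a hyperfinite (internal, $*$-finite) partition of ${}^*X$ into sets of ${}^*\mathcal{A}$, with associated equivalence relation $\sim$ and hyperfinite set of classes $Y={}^*X/{\sim}$, with the following properties. 1. Let $\mathcal{S}$ be the algebra of all internal subsets of $Y$ and put $\nu(T)={}^*\mu(\bigcup T)$ for $T\in\mathcal{S}$. Then $(Y,\mathcal{S},\nu)$ is an internal measure space, $\nu$ has nearstandard values which are bounded by a standard real number, and the Loeb measure $\nu_L:\mathcal{S}_L\to K$ is well defined. 2. The standard-part map $\mathrm{st}_X$ (with domain the nearstandard points of ${}^*X$) factors through $\sim$: if $y\sim y'$, then either both are nearstandard and $\mathrm{st}_X(y)=\mathrm{st}_X(y')$, or neither is nearstandard. The resulting partial map $\mathrm{st}_Y:Y\to X$ is defined outside a Loeb null set of $Y$. 3. $(X,\mathcal{A}_\mu,\mu)$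 is the push-down of $(Y,\mathcal{S}_L,\nu_L)$ via $\mathrm{st}_Y$: a set $A\subseteq X$ belongs to $\mathcal{A}_\mu$ if and only if $\mathrm{st}_Y^{-1}(A)\in\mathcal{S}_L$, and for $A\in\mathcal{A}_\mu$ the limit defining $\mu(A)$ exists and $\mu(A)=\nu_L(\mathrm{st}_Y^{-1}(A))$. In particular $\mathrm{st}_Y$ is measurable and measure-preserving. -/

import Mathlib

open Filter Set Cardinal
open scoped symmDiff

universe u v w

namespace NonArchLoeb

/-! ### Measures with values in a non-Archimedean field -/

section Standard

variable {α : Type u} {K : Type v} [NontriviallyNormedField K]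

/-- `‖A‖_μ = sup {|μ(B)| : B ⊆ A, B ∈ 𝓡}`. -/
noncomputable def setNorm (𝓡 : Set (Set α)) (μ : Set α → K) (A : Set α) : ℝ :=
  sSup {r | ∃ B ∈ 𝓡, B ⊆ A ∧ r = ‖μ B‖}

/-- The norm function `N_μ(x) = inf {‖A‖_μ : x ∈ A ∈ 𝓡}`. -/
noncomputable def weight (𝓡 : Set (Set α)) (μ : Set α → K) (x : α) : ℝ :=
  sInf {r | ∃ A ∈ 𝓡, x ∈ A ∧ r = setNorm 𝓡 μ A}

/-- `μ` is an additive and bounded `K`-valued set function on the covering and separating ring `𝓡`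
of subsets of `Ω`. (The values of `μ` outside `𝓡` are irrelevant.) -/
structure IsContent (Ω : Set α) (𝓡 : Set (Set α)) (μ : Set α → K) : Prop where
  isSetRing : MeasureTheory.IsSetRing 𝓡
  subset_carrier : ∀ A ∈ 𝓡, A ⊆ Ω
  covering : ∀ a ∈ Ω, ∃ A ∈ 𝓡, a ∈ A
  separating : ∀ a ∈ Ω, ∀ b ∈ Ω, a ≠ b → ∃ A ∈ 𝓡, a ∈ A ∧ b ∉ A
  additive : ∀ A ∈ 𝓡, ∀ B ∈ 𝓡, Disjoint A B → μ (A ∪ B) = μ A + μ B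
  bounded : ∀ A ∈ 𝓡, BddAbove {r | ∃ B ∈ 𝓡, B ⊆ A ∧ r = ‖μ B‖}

/-- For an additive bounded set function, the continuity required in `IsMeasureSpace` is equivalent
to `lim ‖A‖_μ = 0` along families that are closed under intersections and have empty intersection
(`A ↦ ‖A‖_μ` is monotone, so that one small value is enough). -/
theorem IsContent.continuous_iff {Ω : Set α} {𝓡 : Set (Set α)} {μ : Set α → K}
    (h : IsContent Ω 𝓡 μ) :
    (∀ 𝓕 ⊆ 𝓡, 𝓕.Nonempty → DirectedOn (fun A B => B ⊆ A) 𝓕 → ⋂₀ 𝓕 = ∅ →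
      ∀ ε : ℝ, 0 < ε → ∃ A ∈ 𝓕, ‖μ A‖ < ε) ↔
    (∀ 𝓕 ⊆ 𝓡, 𝓕.Nonempty → (∀ A ∈ 𝓕, ∀ B ∈ 𝓕, A ∩ B ∈ 𝓕) → ⋂₀ 𝓕 = ∅ →
      ∀ ε : ℝ, 0 < ε → ∃ A ∈ 𝓕, setNorm 𝓡 μ A < ε) := by
  have hinter : ∀ A ∈ 𝓡, ∀ B ∈ 𝓡, A ∩ B ∈ 𝓡 := fun A hA B hB => by
    have := h.isSetRing.sdiff_mem hA (h.isSetRing.sdiff_mem hA hB)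
    rwa [sdiff_sdiff_right_self] at this
  constructor
  · intro hc 𝓕 hF hne hcl hemp ε hε
    by_contra! hlarge
    have key : ∀ A ∈ 𝓕, ∃ A' ∈ 𝓕, ∃ C ∈ 𝓡, A' ⊆ C ∧ C ⊆ A ∧ ε / 4 ≤ ‖μ C‖ := by
      intro A hA
      have hlt : 3 * (ε / 4) < sSup {r | ∃ B ∈ 𝓡, B ⊆ A ∧ r = ‖μ B‖} := by
        have := hlarge A hA
        unfold setNorm at this
        linarith
      obtain ⟨_, ⟨B, hB, hBA, rfl⟩, hBlt⟩ := exists_lt_of_lt_csSup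
        (show {r | ∃ B ∈ 𝓡, B ⊆ A ∧ r = ‖μ B‖}.Nonempty from
          ⟨‖μ ∅‖, ∅, h.isSetRing.empty_mem, empty_subset A, rfl⟩) hlt
      obtain ⟨E, ⟨A₁, hA₁, rfl⟩, hE⟩ := hc ((fun A₁ => B ∩ A₁) '' 𝓕)
        (by rintro _ ⟨A₁, hA₁, rfl⟩; exact hinter _ hB _ (hF hA₁)) (hne.image _)
        (by
          rintro _ ⟨A₁, hA₁, rfl⟩ _ ⟨A₂, hA₂, rfl⟩
          exact ⟨_, ⟨A₁ ∩ A₂, hcl _ hA₁ _ hA₂, rfl⟩, fun x hx => ⟨hx.1, hx.2.1⟩, fun x hx => ⟨hx.1, hx.2.2⟩⟩)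
        (by
          rw [eq_empty_iff_forall_notMem] at hemp ⊢
          intro x hx
          refine hemp x fun A₁ hA₁ => ?_
          exact (hx _ ⟨A₁, hA₁, rfl⟩).2) (ε / 4) (by positivity)
      have hA' := hcl _ hA _ hA₁
      have hD : B \ A₁ ∈ 𝓡 := h.isSetRing.sdiff_mem hB (hF hA₁)
      have hsum := h.additive (B ∩ A₁) (hinter _ hB _ (hF hA₁)) (B \ A₁) hD
        (by rw [Set.disjoint_left]; exact fun x hx hx' => hx'.2 hx.2)
      rw [inter_union_sdiff] at hsum
      have h1 := norm_add_le (μ (B ∩ A₁)) (μ (B \ A₁))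
      rw [← hsum] at h1
      dsimp only at hE
      by_cases hsmall : ε / 4 ≤ ‖μ (A ∩ A₁)‖
      · exact ⟨_, hA', _, hF hA', subset_rfl, inter_subset_left, hsmall⟩
      · refine ⟨_, hA', (A ∩ A₁) ∪ (B \ A₁), h.isSetRing.union_mem (hF hA') hD,
          subset_union_left,
          union_subset inter_subset_left (sdiff_subset.trans hBA), ?_⟩
        rw [h.additive _ (hF hA') _ hD (by rw [Set.disjoint_left]; exact fun x hx hx' => hx'.2 hx.2)]
        have h2 := norm_sub_le (μ (A ∩ A₁) + μ (B \ A₁)) (μ (A ∩ A₁))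
        rw [add_sub_cancel_left] at h2
        linarith
    obtain ⟨C, ⟨_, _, _, _, _, _, hC⟩, hC'⟩ := hc
      {C | C ∈ 𝓡 ∧ ∃ A ∈ 𝓕, ∃ A' ∈ 𝓕, A' ⊆ C ∧ C ⊆ A ∧ ε / 4 ≤ ‖μ C‖}
      (fun C hC => hC.1)
      (by
        obtain ⟨A, hA⟩ := hne
        obtain ⟨A', hA', C, hC, h1, h2, h3⟩ := key A hA
        exact ⟨C, hC, A, hA, A', hA', h1, h2, h3⟩)
      (by
        rintro C₁ ⟨-, A₁, -, A₁', hA₁', h₁, -, -⟩ C₂ ⟨-, A₂, -, A₂', hA₂', h₂, -, -⟩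
        obtain ⟨A', hA', C, hC, h1, h2, h3⟩ := key _ (hcl _ hA₁' _ hA₂')
        exact ⟨C, ⟨hC, _, hcl _ hA₁' _ hA₂', A', hA', h1, h2, h3⟩,
          (h2.trans inter_subset_left).trans h₁, (h2.trans inter_subset_right).trans h₂⟩)
      (by
        rw [eq_empty_iff_forall_notMem] at hemp ⊢
        intro x hx
        refine hemp x fun A hA => ?_
        obtain ⟨A', hA', C, hC, h1, h2, h3⟩ := key A hA
        exact h2 (hx C ⟨hC, A, hA, A', hA', h1, h2, h3⟩)) (ε / 4) (by positivity)
    linarith [hC]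
  · intro hc 𝓕 hF hne hdir hemp ε hε
    obtain ⟨B, ⟨hB, A, hA, hAB⟩, hlt⟩ := hc {B | B ∈ 𝓡 ∧ ∃ A ∈ 𝓕, A ⊆ B} (fun B hB => hB.1)
      (hne.imp fun A hA => ⟨hF hA, A, hA, subset_rfl⟩)
      (by
        rintro B₁ ⟨hB₁, A₁, hA₁, h₁⟩ B₂ ⟨hB₂, A₂, hA₂, h₂⟩
        obtain ⟨A, hA, hA1, hA2⟩ := hdir A₁ hA₁ A₂ hA₂
        exact ⟨hinter _ hB₁ _ hB₂, A, hA, subset_inter (hA1.trans h₁) (hA2.trans h₂)⟩)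
      (by
        rw [eq_empty_iff_forall_notMem] at hemp ⊢
        exact fun x hx => hemp x fun A hA => hx A ⟨hF hA, A, hA, subset_rfl⟩) ε hε
    exact ⟨A, hA, (le_csSup (h.bounded B hB) ⟨A, hF hA, hAB, rfl⟩).trans_lt hlt⟩

/-- `(X, 𝓡, μ)` is a `K`-valued measure space on the whole type `X = α`: an additive and bounded
set function on a covering and separating ring which is continuous along shrinking families.
A family is shrinking if the intersection of any two members contains a member. -/
structure IsMeasureSpace (𝓡 : Set (Set α)) (μ : Set α → K) : Prop
    extends IsContent univ 𝓡 μ where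
  continuous : ∀ 𝓕 ⊆ 𝓡, 𝓕.Nonempty → DirectedOn (fun A B => B ⊆ A) 𝓕 → ⋂₀ 𝓕 = ∅ →
    ∀ ε : ℝ, 0 < ε → ∃ A ∈ 𝓕, ‖μ A‖ < ε

/-- The extended ring `𝓡_μ`: the sets that can be approximated by sets of `𝓡`. -/
def extendedRing (𝓡 : Set (Set α)) (μ : Set α → K) : Set (Set α) :=
  {A | ∀ ε : ℝ, 0 < ε → ∃ B ∈ 𝓡, ∀ x ∈ A ∆ B, weight 𝓡 μ x ≤ ε}

/-- `A` belongs to the extended ring and its extended measure `lim_{ε → 0} μ(B_ε)` exists and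
equals `c`; here `B_ε` is any set of `𝓡` with `N_μ ≤ ε` on `A ∆ B_ε`. -/
def HasExtendedMeasure (𝓡 : Set (Set α)) (μ : Set α → K) (A : Set α) (c : K) : Prop :=
  A ∈ extendedRing 𝓡 μ ∧
    ∀ δ : ℝ, 0 < δ → ∃ ε : ℝ, 0 < ε ∧
      ∀ B ∈ 𝓡, (∀ x ∈ A ∆ B, weight 𝓡 μ x ≤ ε) → ‖μ B - c‖ < δ

end Standard

/-- A finitely additive, bounded `K`-valued measure space whose underlying set is a subset
of `α`. -/
structure ContentSpace (α : Type u) (K : Type v) [NontriviallyNormedField K] where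
  carrier : Set α
  sets : Set (Set α)
  meas : Set α → K
  isContent : IsContent carrier sets meas

/-! ### Nonstandard extensions -/

section Nonstandard

variable {I : Type w}

/-- The nonstandard extension `*α`, as the ultrapower of `α` modulo `U`. The image in `*α` of a
standard `a : α` is the class of the constant family, written `(a : Star U α)`. -/
abbrev Star (U : Ultrafilter I) (α : Type u) : Type (max u w) := Germ (U : Filter I) α

variable {U : Ultrafilter I} {α : Type u}

/-- The elements of `*(Set α)` are the internal subsets of `*α`; `ext S` is `S` regarded as an
actual set of elements of `*α`. In particular `ext (A : Star U (Set α))` is `*A` for a standard set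
`A`. -/
def ext (S : Star U (Set α)) : Set (Star U α) := {x | Germ.LiftRel (fun a A => a ∈ A) x S}

/-- `κ`-saturation: a family of at most `κ` internal sets all of whose finite subfamilies have
nonempty intersection has nonempty intersection. -/
def IsSaturated (U : Ultrafilter I) (κ : Cardinal.{u}) : Prop :=
  ∀ (α : Type u) (J : Type u), #J ≤ κ → ∀ F : J → Star U (Set α),
    (∀ s : Finset J, (⋂ j ∈ s, ext (F j)).Nonempty) → (⋂ j, ext (F j)).Nonempty

/-- The monad of `a`: the intersection of all `*A`, where `A` is an open neighbourhood of `a`. -/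
def monad [TopologicalSpace α] (U : Ultrafilter I) (a : α) : Set (Star U α) :=
  {x | ∀ A : Set α, IsOpen A → a ∈ A → x ∈ ext (A : Star U (Set α))}

/-- The standard-part map, as a partial map with domain the nearstandard points. (On a Hausdorff
space the monads are disjoint, so that the chosen point is the only one.) -/
noncomputable def standardPart (U : Ultrafilter I) (α : Type u) [TopologicalSpace α] :
    Star U α →. α :=
  fun x => ⟨∃ a, x ∈ monad U a, fun h => h.choose⟩

/-- The standard-part map `st_X` for the topology on `X` with base `𝓡`. -/
noncomputable def standardPartOf (U : Ultrafilter I) {X : Type u} (𝓡 : Set (Set X)) :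
    Star U X →. X :=
  @standardPart I U X (TopologicalSpace.generateFrom 𝓡)

/-- `P` is a hyperfinite (internal, star-finite) family of internal subsets of `*X` that all belong
to `*𝓡` and form a partition of `*X`. -/
structure IsHyperfinitePartition {X : Type u} (𝓡 : Set (Set X)) (P : Star U (Set (Set X))) :
    Prop where
  hyperfinite : Germ.LiftPred Set.Finite P
  subset : ∀ R ∈ ext P, R ∈ ext (𝓡 : Star U (Set (Set X)))
  isPartition : Setoid.IsPartition (ext '' ext P)

/-! ### Internal measure spaces and their Loeb spaces -/

variable {K : Type v} [NontriviallyNormedField K]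

/-- An internal measure space `(Ω, 𝒮, ν)` with values in `*K`, where `Ω` is an internal subset
of `*α`: it is represented by a family of finitely additive measure spaces. -/
abbrev InternalMeasureSpace (U : Ultrafilter I) (α : Type u) (K : Type v)
    [NontriviallyNormedField K] : Type (max u v w) :=
  Star U (ContentSpace α K)

namespace InternalMeasureSpace

/-- The underlying internal set `Ω`. -/
def carrier (M : InternalMeasureSpace U α K) : Star U (Set α) := Germ.map ContentSpace.carrier M

/-- The internal ring `𝒮` of measurable sets. -/
def sets (M : InternalMeasureSpace U α K) : Star U (Set (Set α)) := Germ.map ContentSpace.sets M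

/-- The internal measure `ν`. -/
def meas (M : InternalMeasureSpace U α K) (B : Star U (Set α)) : Star U K :=
  Germ.map₂ ContentSpace.meas M B

/-- The internal norm function `N_ν`. -/
noncomputable def weight (M : InternalMeasureSpace U α K) (x : Star U α) : Star U ℝ :=
  Germ.map₂ (fun m a => NonArchLoeb.weight m.sets m.meas a) M x

/-- Loeb null sets: (possibly external) subsets of `Ω` on which `N_ν` is infinitesimal. -/
def LoebNull (M : InternalMeasureSpace U α K) (A : Set (Star U α)) : Prop :=
  A ⊆ ext M.carrier ∧ ∀ x ∈ A, M.weight x ∈ monad U (0 : ℝ)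

/-- The ring `𝒮_L` of Loeb measurable sets. -/
def loebSets (M : InternalMeasureSpace U α K) : Set (Set (Star U α)) :=
  {A | A ⊆ ext M.carrier ∧ ∃ B ∈ ext M.sets, M.LoebNull (A ∆ ext B)}

/-- `A` is Loeb measurable and its Loeb measure is well defined and equal to `c`: the standard part
of `ν(B)` is `c` for every `B ∈ 𝒮` which differs from `A` by a Loeb null set. -/
def HasLoebMeasure (M : InternalMeasureSpace U α K) (A : Set (Star U α)) (c : K) : Prop :=
  A ∈ M.loebSets ∧
    ∀ B ∈ ext M.sets, M.LoebNull (A ∆ ext B) → M.meas B ∈ monad U c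

end InternalMeasureSpace

end Nonstandard

end NonArchLoeb

namespace NonArchLoeb

/-! ### Norms and finite norming partitions -/

section StandardLemmas

/-! The quotient is built from a hyperfinite partition that refines every standard set of `𝒜` and is
norming: `‖R‖_μ ≤ 2|μ(R)|` for each class `R`. Finite partitions that are norming and refine
finitely many given sets exist by `IsContent.exists_norming_subset`; saturation over the at most `κ`
members of `𝒜` yields the hyperfinite one.

Classes are the points of the quotient, so its norm function at `R` is `|*μ(R)|`, and a set of
classes is Loeb null exactly when `*μ` is infinitesimal on each of them. By the ultrametric
inequality a union of classes has measure at most the largest measure among them, however many there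
are. Hence internal sets that differ by a Loeb null set have infinitely close measures, and the Loeb
measure is well defined.

Every class decides every standard set `A`: it lies in `*A` or in its complement. The standard sets
around a class therefore have either a common standard point, which is the standard part of every
element of the class, or empty intersection. In the second case continuity of `μ` makes the measure
of the class infinitesimal, so `st_Y` is defined almost everywhere.

If `A` lies in the extended algebra, its approximants `B_n` give internal sets of classes, and
countable saturation supplies a single internal set that is close to all of them
(`exists_isLoebApprox`). The converse (`mem_extendedRing_of_isLoebApprox`) is a compactness
argument: given an internal approximant and `ε > 0`, finitely many sets of `𝒜` cover `X` such that
in each of them the classes of measure at least `ε` are all inside or all outside the approximant.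
Here the norming property is essential, since it turns a large weight at a standard point into a
large measure of the class of that point. -/

theorem norm_sub_le_max {E : Type*} [SeminormedAddCommGroup E] [IsUltrametricDist E] (a b : E) :
    ‖a - b‖ ≤ max ‖a‖ ‖b‖ := by
  simpa [sub_eq_add_neg] using IsUltrametricDist.norm_add_le_max a (-b)

variable {α : Type u} {K : Type v} [NontriviallyNormedField K]
  {Ω : Set α} {𝓡 : Set (Set α)} {μ : Set α → K}

theorem setNorm_nonneg (A : Set α) : 0 ≤ setNorm 𝓡 μ A :=
  Real.sSup_nonneg (by rintro _ ⟨B, -, -, rfl⟩; exact norm_nonneg _)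

theorem IsContent.norm_le_setNorm (h : IsContent Ω 𝓡 μ) {A B : Set α} (hA : A ∈ 𝓡) (hB : B ∈ 𝓡)
    (hBA : B ⊆ A) : ‖μ B‖ ≤ setNorm 𝓡 μ A :=
  le_csSup (h.bounded A hA) ⟨B, hB, hBA, rfl⟩

theorem IsContent.setNorm_mono (h : IsContent Ω 𝓡 μ) {A B : Set α} (hA : A ∈ 𝓡) (hBA : B ⊆ A) :
    setNorm 𝓡 μ B ≤ setNorm 𝓡 μ A :=
  csSup_le_csSup (h.bounded A hA) ⟨_, ∅, h.isSetRing.empty_mem, empty_subset _, rfl⟩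
    fun _ ⟨C, hC, hCB, hr⟩ => ⟨C, hC, hCB.trans hBA, hr⟩

theorem IsContent.inter_mem (h : IsContent Ω 𝓡 μ) {A B : Set α} (hA : A ∈ 𝓡) (hB : B ∈ 𝓡) :
    A ∩ B ∈ 𝓡 := by
  have := h.isSetRing.sdiff_mem hA (h.isSetRing.sdiff_mem hA hB)
  rwa [sdiff_sdiff_right_self] at this

theorem IsContent.meas_empty (h : IsContent Ω 𝓡 μ) : μ ∅ = 0 := by
  have := h.additive ∅ h.isSetRing.empty_mem ∅ h.isSetRing.empty_mem (disjoint_empty _)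
  simpa using this

theorem IsContent.sUnion_mem (h : IsContent Ω 𝓡 μ) {T : Set (Set α)} (hT : T.Finite)
    (hsub : T ⊆ 𝓡) : ⋃₀ T ∈ 𝓡 := by
  induction T, hT using Set.Finite.induction_on with
  | empty => simpa using h.isSetRing.empty_mem
  | insert _ _ ih =>
    rw [sUnion_insert]
    exact h.isSetRing.union_mem (hsub (mem_insert _ _))
      (ih fun R hR => hsub (mem_insert_of_mem _ hR))

theorem weight_le_setNorm {A : Set α} (hA : A ∈ 𝓡) {x : α} (hx : x ∈ A) :
    weight 𝓡 μ x ≤ setNorm 𝓡 μ A :=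
  csInf_le ⟨0, by rintro _ ⟨B, -, -, rfl⟩; exact setNorm_nonneg _⟩ ⟨A, hA, hx, rfl⟩

theorem IsContent.exists_setNorm_lt (h : IsContent Ω 𝓡 μ) {x : α} (hx : x ∈ Ω) {ε : ℝ}
    (hε : weight 𝓡 μ x < ε) : ∃ A ∈ 𝓡, x ∈ A ∧ setNorm 𝓡 μ A < ε := by
  obtain ⟨A, hA, hxA⟩ := h.covering x hx
  obtain ⟨_, ⟨B, hB, hxB, rfl⟩, hlt⟩ := exists_lt_of_csInf_lt
    (show {r | ∃ A ∈ 𝓡, x ∈ A ∧ r = setNorm 𝓡 μ A}.Nonempty from ⟨_, A, hA, hxA, rfl⟩) hε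
  exact ⟨B, hB, hxB, hlt⟩

/-- A finite partition into sets of `𝓡` on each of which the norm of the value of `μ` is comparable
to the norm of the set. -/
structure IsNormingPartition (𝓡 : Set (Set α)) (μ : Set α → K) (P : Set (Set α)) : Prop where
  finite : P.Finite
  subset : P ⊆ 𝓡
  isPartition : Setoid.IsPartition P
  setNorm_le : ∀ R ∈ P, setNorm 𝓡 μ R ≤ 2 * ‖μ R‖

theorem eq_of_isPartition {P : Set (Set α)} (hP : Setoid.IsPartition P) {R R' : Set α} (hR : R ∈ P)
    (hR' : R' ∈ P) {x : α} (hx : x ∈ R) (hx' : x ∈ R') : R = R' :=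
  (hP.2 x).unique ⟨hR, hx⟩ ⟨hR', hx'⟩

theorem exists_mem_of_isPartition {P : Set (Set α)} (hP : Setoid.IsPartition P) (x : α) :
    ∃ R ∈ P, x ∈ R := (hP.2 x).exists

theorem nonempty_of_isPartition {P : Set (Set α)} (hP : Setoid.IsPartition P) {R : Set α}
    (hR : R ∈ P) : R.Nonempty :=
  nonempty_iff_ne_empty.2 fun h => hP.1 (h ▸ hR)

/-- Splitting each member of a finite partition into two parts. -/
theorem exists_split_partition (h𝓡 : MeasureTheory.IsSetRing 𝓡) {P : Set (Set α)}
    (hfin : P.Finite) (hsub : P ⊆ 𝓡) (hpart : Setoid.IsPartition P) (g : Set α → Set α)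
    (hg : ∀ R ∈ P, g R ∈ 𝓡 ∧ g R ⊆ R) :
    ∃ Q : Set (Set α), Q.Finite ∧ Q ⊆ 𝓡 ∧ Setoid.IsPartition Q ∧
      ∀ C ∈ Q, ∃ R ∈ P, C = g R ∨ C = R \ g R := by
  refine ⟨{C | C.Nonempty ∧ ∃ R ∈ P, C = g R ∨ C = R \ g R}, ?_, ?_, ⟨?_, ?_⟩, fun C hC => hC.2⟩
  · refine ((hfin.image g).union (hfin.image fun R => R \ g R)).subset ?_
    rintro C ⟨-, R, hR, rfl | rfl⟩
    exacts [Or.inl ⟨R, hR, rfl⟩, Or.inr ⟨R, hR, rfl⟩]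
  · rintro C ⟨-, R, hR, rfl | rfl⟩
    exacts [(hg R hR).1, h𝓡.sdiff_mem (hsub hR) (hg R hR).1]
  · rintro ⟨⟨x, hx⟩, -⟩
    exact hx
  · intro x
    obtain ⟨R, hR, hxR⟩ := exists_mem_of_isPartition hpart x
    have key : ∀ C, (C.Nonempty ∧ ∃ R ∈ P, C = g R ∨ C = R \ g R) ∧ x ∈ C →
        C = g R ∨ C = R \ g R := by
      rintro C ⟨⟨-, R', hR', hC⟩, hxC⟩
      have hCR : C ⊆ R' := by
        rcases hC with rfl | rfl
        exacts [(hg R' hR').2, sdiff_subset]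
      rwa [eq_of_isPartition hpart hR hR' hxR (hCR hxC)]
    by_cases hx : x ∈ g R
    · refine ⟨g R, ⟨⟨⟨x, hx⟩, R, hR, Or.inl rfl⟩, hx⟩, fun C hC => ?_⟩
      rcases key C hC with h | rfl
      exacts [h, absurd hx hC.2.2]
    · refine ⟨R \ g R, ⟨⟨⟨x, hxR, hx⟩, R, hR, Or.inr rfl⟩, hxR, hx⟩, fun C hC => ?_⟩
      rcases key C hC with rfl | h
      exacts [absurd hC.2 hx, h]

theorem exists_refining_partition (h𝓡 : MeasureTheory.IsSetAlgebra 𝓡) (s : Finset (Set α))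
    (hs : ∀ A ∈ s, A ∈ 𝓡) :
    ∃ P : Set (Set α), P.Finite ∧ P ⊆ 𝓡 ∧ Setoid.IsPartition P ∧
      ∀ A ∈ s, ∀ R ∈ P, R ⊆ A ∨ R ⊆ Aᶜ := by
  classical
  have hring := h𝓡.isSetRing
  induction s using Finset.induction_on with
  | empty =>
    -- The nonemptiness condition handles an empty space, whose only partition is the empty one.
    refine ⟨{C | C = Set.univ ∧ C.Nonempty}, (finite_singleton Set.univ).subset fun C hC => hC.1, ?_,
      ⟨fun h => not_nonempty_empty h.2, fun x => ?_⟩, by simp⟩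
    · rintro C ⟨rfl, -⟩
      exact h𝓡.univ_mem
    · exact ⟨Set.univ, ⟨⟨rfl, ⟨x, trivial⟩⟩, trivial⟩, fun C hC => hC.1.1⟩
  | insert A s _ ih =>
    obtain ⟨P, hfin, hsub, hpart, href⟩ := ih fun B hB => hs B (Finset.mem_insert_of_mem hB)
    have hA : A ∈ 𝓡 := hs A (Finset.mem_insert_self _ _)
    obtain ⟨Q, hQf, hQs, hQp, hQ⟩ := exists_split_partition hring hfin hsub hpart (fun R => R \ A)
      fun R hR => ⟨hring.sdiff_mem (hsub hR) hA, sdiff_subset⟩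
    refine ⟨Q, hQf, hQs, hQp, fun B hB C hC => ?_⟩
    obtain ⟨R, hR, hCR⟩ := hQ C hC
    rcases Finset.mem_insert.1 hB with rfl | hB
    · rcases hCR with rfl | rfl
      · exact Or.inr fun x hx => hx.2
      · exact Or.inl fun x hx => by_contra fun hxB => hx.2 ⟨hx.1, hxB⟩
    · have hCR' : C ⊆ R := by
        rcases hCR with rfl | rfl <;> exact sdiff_subset
      exact (href B hB R hR).imp hCR'.trans hCR'.trans

/-- If `R` itself is not norming, some `B ⊆ R` has `|μ(B)|` more than half of `‖R‖_μ`, while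
`|μ(R)|` is at most half of it. The ultrametric inequality then forces `|μ(R \ B)| ≥ |μ(B)|`, so
both parts are norming. -/
theorem IsContent.exists_norming_subset [IsUltrametricDist K] (h : IsContent Ω 𝓡 μ) {R : Set α}
    (hR : R ∈ 𝓡) : ∃ B ∈ 𝓡, B ⊆ R ∧ setNorm 𝓡 μ B ≤ 2 * ‖μ B‖ ∧
      setNorm 𝓡 μ (R \ B) ≤ 2 * ‖μ (R \ B)‖ := by
  by_cases hsmall : setNorm 𝓡 μ R ≤ 2 * ‖μ R‖
  · refine ⟨R, hR, subset_rfl, hsmall, ?_⟩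
    have : setNorm 𝓡 μ (∅ : Set α) ≤ 0 := by
      refine Real.sSup_nonpos ?_
      rintro _ ⟨B, -, hB, rfl⟩
      rw [subset_empty_iff.1 hB, h.meas_empty, norm_zero]
    simpa [h.meas_empty] using this
  · push Not at hsmall
    have hpos : 0 < setNorm 𝓡 μ R := lt_of_le_of_lt (by positivity) hsmall
    obtain ⟨_, ⟨B, hB, hBR, rfl⟩, hlt⟩ := exists_lt_of_lt_csSup
      (show {r | ∃ B ∈ 𝓡, B ⊆ R ∧ r = ‖μ B‖}.Nonempty from
        ⟨_, ∅, h.isSetRing.empty_mem, empty_subset _, rfl⟩) (half_lt_self hpos)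
    have hlt' : setNorm 𝓡 μ R < 2 * ‖μ B‖ := (div_lt_iff₀' two_pos).1 hlt
    have hadd := h.additive B hB (R \ B) (h.isSetRing.sdiff_mem hR hB) disjoint_sdiff_self_right
    rw [union_sdiff_cancel hBR] at hadd
    have hle : ‖μ B‖ ≤ ‖μ (R \ B)‖ := by
      have h1 := norm_sub_le_max (μ R) (μ (R \ B))
      rw [hadd, add_sub_cancel_right, ← hadd] at h1
      rcases le_max_iff.1 h1 with h2 | h2
      · linarith
      · exact h2
    refine ⟨B, hB, hBR, (h.setNorm_mono hR hBR).trans hlt'.le,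
      (h.setNorm_mono hR sdiff_subset).trans (by linarith)⟩

theorem IsContent.exists_isNormingPartition [IsUltrametricDist K] (h : IsContent Ω 𝓡 μ)
    (h𝓡 : MeasureTheory.IsSetAlgebra 𝓡) (s : Finset (Set α)) (hs : ∀ A ∈ s, A ∈ 𝓡) :
    ∃ P : Set (Set α), IsNormingPartition 𝓡 μ P ∧ ∀ A ∈ s, ∀ R ∈ P, R ⊆ A ∨ R ⊆ Aᶜ := by
  obtain ⟨P, hfin, hsub, hpart, href⟩ := exists_refining_partition h𝓡 s hs
  choose! g hg1 hg2 hg3 hg4 using fun R (hR : R ∈ P) => h.exists_norming_subset (hsub hR)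
  obtain ⟨Q, hQf, hQs, hQp, hQ⟩ := exists_split_partition h.isSetRing hfin hsub hpart g
    fun R hR => ⟨hg1 R hR, hg2 R hR⟩
  refine ⟨Q, ⟨hQf, hQs, hQp, fun C hC => ?_⟩, fun A hA C hC => ?_⟩
  · obtain ⟨R, hR, rfl | rfl⟩ := hQ C hC
    exacts [hg3 R hR, hg4 R hR]
  · obtain ⟨R, hR, hCR⟩ := hQ C hC
    have hCR' : C ⊆ R := by
      rcases hCR with rfl | rfl
      exacts [hg2 R hR, sdiff_subset]
    exact (href A hA R hR).imp hCR'.trans hCR'.trans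

theorem disjoint_sUnion_of_isPartition {P T T' : Set (Set α)} (hP : Setoid.IsPartition P)
    (hT : T ⊆ P) (hT' : T' ⊆ P) (hd : Disjoint T T') : Disjoint (⋃₀ T) (⋃₀ T') := by
  rw [Set.disjoint_left] at hd ⊢
  rintro x ⟨R, hR, hx⟩ ⟨R', hR', hx'⟩
  exact hd hR (eq_of_isPartition hP (hT hR) (hT' hR') hx hx' ▸ hR')

/-! ### The finite quotient of a norming partition -/

namespace IsNormingPartition

variable {P T T' : Set (Set α)}

theorem sUnion_mem (hP : IsNormingPartition 𝓡 μ P) (h : IsContent Ω 𝓡 μ) (hT : T ⊆ P) :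
    ⋃₀ T ∈ 𝓡 :=
  h.sUnion_mem (hP.finite.subset hT) (hT.trans hP.subset)

theorem meas_sUnion_union (hP : IsNormingPartition 𝓡 μ P) (h : IsContent Ω 𝓡 μ) (hT : T ⊆ P)
    (hT' : T' ⊆ P) (hd : Disjoint T T') : μ (⋃₀ (T ∪ T')) = μ (⋃₀ T) + μ (⋃₀ T') := by
  rw [sUnion_union]
  exact h.additive _ (hP.sUnion_mem h hT) _ (hP.sUnion_mem h hT')
    (disjoint_sUnion_of_isPartition hP.isPartition hT hT' hd)

/-- The bound does not depend on the number of classes, which is what lets it pass to hyperfinite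
unions. -/
theorem norm_meas_sUnion_le [IsUltrametricDist K] (hP : IsNormingPartition 𝓡 μ P)
    (h : IsContent Ω 𝓡 μ) (hT : T ⊆ P) {ε : ℝ} (hε : 0 ≤ ε) (hle : ∀ R ∈ T, ‖μ R‖ ≤ ε) :
    ‖μ (⋃₀ T)‖ ≤ ε := by
  have hfin := hP.finite.subset hT
  induction T, hfin using Set.Finite.induction_on with
  | empty => simpa [h.meas_empty] using hε
  | @insert R T hR _ ih =>
    rw [insert_subset_iff] at hT
    rw [insert_eq, hP.meas_sUnion_union h (singleton_subset_iff.2 hT.1) hT.2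
      (disjoint_singleton_left.2 hR), sUnion_singleton]
    exact (IsUltrametricDist.norm_add_le_max _ _).trans (max_le (hle R (mem_insert _ _))
      (ih hT.2 fun C hC => hle C (mem_insert_of_mem _ hC)))

theorem norm_meas_sUnion_sub_le [IsUltrametricDist K] (hP : IsNormingPartition 𝓡 μ P)
    (h : IsContent Ω 𝓡 μ) (hT : T ⊆ P) (hT' : T' ⊆ P) {ε : ℝ} (hε : 0 ≤ ε)
    (hle : ∀ R ∈ T ∆ T', ‖μ R‖ ≤ ε) : ‖μ (⋃₀ T) - μ (⋃₀ T')‖ ≤ ε := by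
  have h1 := hP.meas_sUnion_union h (T := T ∩ T') (T' := T \ T') (inter_subset_left.trans hT)
    (sdiff_subset.trans hT) (Set.disjoint_left.2 fun x hx hx' => hx'.2 hx.2)
  have h2 := hP.meas_sUnion_union h (T := T' ∩ T) (T' := T' \ T) (inter_subset_left.trans hT')
    (sdiff_subset.trans hT') (Set.disjoint_left.2 fun x hx hx' => hx'.2 hx.2)
  rw [inter_union_sdiff] at h1 h2
  rw [h1, h2, inter_comm T' T, add_sub_add_left_eq_sub]
  refine (norm_sub_le_max _ _).trans (max_le ?_ ?_)
  · exact hP.norm_meas_sUnion_le h (sdiff_subset.trans hT) hε fun R hR => hle R (Or.inl hR)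
  · exact hP.norm_meas_sUnion_le h (sdiff_subset.trans hT') hε fun R hR => hle R (Or.inr hR)

theorem isContent (hP : IsNormingPartition 𝓡 μ P) (h : IsContent Set.univ 𝓡 μ)
    (hu : Set.univ ∈ 𝓡) : IsContent P (𝒫 P) (fun T => μ (⋃₀ T)) where
  isSetRing :=
    { empty_mem := empty_subset _
      union_mem := fun _ _ hs ht => union_subset hs ht
      sdiff_mem := fun _ _ hs _ => sdiff_subset.trans hs }
  subset_carrier := fun _ hA => hA
  covering := fun R hR => ⟨{R}, singleton_subset_iff.2 hR, rfl⟩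
  separating := fun R hR _ _ hne => ⟨{R}, singleton_subset_iff.2 hR, rfl, fun h => hne h.symm⟩
  additive := fun _ hA _ hB hd => hP.meas_sUnion_union h hA hB hd
  bounded := fun _ _ => ⟨setNorm 𝓡 μ Set.univ, by
    rintro _ ⟨B, hB, -, rfl⟩
    exact h.norm_le_setNorm hu (hP.sUnion_mem h hB) (subset_univ _)⟩

/-- The finite quotient measure space of a partition. -/
def contentSpace (hP : IsNormingPartition 𝓡 μ P) (h : IsContent Set.univ 𝓡 μ) (hu : Set.univ ∈ 𝓡) :
    ContentSpace (Set α) K := ⟨P, 𝒫 P, fun T => μ (⋃₀ T), hP.isContent h hu⟩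

/-- The singleton `{R}` is the least measurable set containing the point `R`, and its only other
subset is empty. -/
theorem weight_eq (hP : IsNormingPartition 𝓡 μ P) (h : IsContent Set.univ 𝓡 μ) (hu : Set.univ ∈ 𝓡)
    {R : Set α} (hR : R ∈ P) : weight (𝒫 P) (fun T => μ (⋃₀ T)) R = ‖μ R‖ := by
  have hc := hP.isContent h hu
  have hs : {R} ∈ 𝒫 P := singleton_subset_iff.2 hR
  apply le_antisymm
  · refine (weight_le_setNorm hs (mem_singleton R)).trans (Real.sSup_le ?_ (norm_nonneg _))
    rintro _ ⟨T, -, hT, rfl⟩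
    rcases subset_singleton_iff_eq.1 hT with rfl | rfl
    · simp [h.meas_empty]
    · simp
  · refine le_csInf ⟨_, {R}, hs, rfl, rfl⟩ ?_
    rintro _ ⟨T, hT, hRT, rfl⟩
    simpa using hc.norm_le_setNorm hT hs (singleton_subset_iff.2 hRT)

theorem sUnion_subset_eq (hP : IsNormingPartition 𝓡 μ P) {B : Set α}
    (hB : ∀ R ∈ P, R ⊆ B ∨ R ⊆ Bᶜ) : ⋃₀ {R ∈ P | R ⊆ B} = B := by
  apply subset_antisymm
  · exact sUnion_subset fun R hR => hR.2
  · intro x hx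
    obtain ⟨R, hR, hxR⟩ := exists_mem_of_isPartition hP.isPartition x
    rcases hB R hR with h | h
    · exact ⟨R, ⟨hR, h⟩, hxR⟩
    · exact absurd hx (h hxR)

end IsNormingPartition

end StandardLemmas

/-! ### Hyperfinite partitions and limit points, in terms of representatives -/

section Coordinates

variable {I : Type w} {U : Ultrafilter I}

/-- Saturation in terms of representatives: finite satisfiability is checked index by index, and the
common point is a single family. -/
theorem IsSaturated.exists_family {κ : Cardinal.{u}} (hU : IsSaturated U κ) {α J : Type u}
    (hJ : #J ≤ κ) (F : J → I → Set α)
    (h : ∀ s : Finset J, ∀ᶠ i in U, ∃ a, ∀ j ∈ s, a ∈ F j i) :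
    ∃ f : I → α, ∀ j, ∀ᶠ i in U, f i ∈ F j i := by
  obtain ⟨x, hx⟩ := hU α J hJ (fun j => (F j : Star U (Set α))) fun s => by
    obtain ⟨f, hf⟩ := (h s).choice
    refine ⟨(f : Star U α), mem_iInter₂.2 fun j hj => ?_⟩
    exact hf.mono fun i hi => hi j hj
  induction x using Germ.inductionOn with
  | h f => exact ⟨f, fun j => mem_iInter.1 hx j⟩

variable {X : Type u} {K : Type v} [NontriviallyNormedField K] {𝒜 : Set (Set X)} {μ : Set X → K}

/-- All members of the standard ring containing `x` eventually contain the sets `r i`. -/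
def IsLimitPoint (U : Ultrafilter I) (𝒜 : Set (Set X)) (r : I → Set X) (x : X) : Prop :=
  ∀ A ∈ 𝒜, x ∈ A → ∀ᶠ i in U, r i ⊆ A

/-- A hyperfinite partition, given by representatives, which refines all standard sets of `𝒜`. -/
structure IsRefiningPartition (U : Ultrafilter I) (𝒜 : Set (Set X)) (μ : Set X → K)
    (p : I → Set (Set X)) : Prop where
  norming : ∀ i, IsNormingPartition 𝒜 μ (p i)
  refines : ∀ A ∈ 𝒜, ∀ᶠ i in U, ∀ R ∈ p i, R ⊆ A ∨ R ⊆ Aᶜ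

theorem exists_isRefiningPartition [IsUltrametricDist K] {κ : Cardinal.{u}} (hU : IsSaturated U κ)
    (h𝒜 : MeasureTheory.IsSetAlgebra 𝒜) (hμ : IsMeasureSpace 𝒜 μ) (h𝒜κ : #𝒜 ≤ κ) :
    ∃ p, IsRefiningPartition U 𝒜 μ p := by
  classical
  have hex : ∀ s : Finset 𝒜, ∃ P, IsNormingPartition 𝒜 μ P ∧
      ∀ A ∈ s, ∀ R ∈ P, R ⊆ (A : Set X) ∨ R ⊆ (A : Set X)ᶜ := fun s => by
    obtain ⟨P, hP, h⟩ := hμ.exists_isNormingPartition h𝒜 (s.image Subtype.val) (by simp +contextual)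
    exact ⟨P, hP, fun A hA => h A (Finset.mem_image_of_mem _ hA)⟩
  obtain ⟨P₀, hP₀, -⟩ := hex ∅
  obtain ⟨p, hp⟩ := hU.exists_family h𝒜κ (fun A _ => {P : Set (Set X) | IsNormingPartition 𝒜 μ P ∧
    ∀ R ∈ P, R ⊆ (A : Set X) ∨ R ⊆ (A : Set X)ᶜ}) fun s => by
      obtain ⟨P, hP, h⟩ := hex s
      exact Eventually.of_forall fun _ => ⟨P, fun A hA => ⟨hP, h A hA⟩⟩
  -- Saturation controls `p` only on sets of the ultrafilter; replacing the remaining values by `P₀`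
  -- makes the partition norming at every index.
  refine ⟨fun i => if IsNormingPartition 𝒜 μ (p i) then p i else P₀, fun i => ?_, fun A hA => ?_⟩
  · split_ifs with h
    exacts [h, hP₀]
  · filter_upwards [hp ⟨A, hA⟩] with i hi
    rw [if_pos hi.1]
    exact hi.2

theorem eventually_iff_or_mem_symmDiff {β : Type*} (r : I → β) (t t' : I → Set β) :
    (∀ᶠ i in U, r i ∈ t i ∆ t' i) ∨ ((∀ᶠ i in U, r i ∈ t i) ↔ ∀ᶠ i in U, r i ∈ t' i) := by
  rcases U.em fun i => r i ∈ t i ∆ t' i with h | h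
  · exact Or.inl h
  · refine Or.inr (eventually_congr (h.mono fun i hi => ?_))
    rw [mem_symmDiff] at hi
    tauto

/-- The internal set `t` of classes differs by a Loeb null set from the external set of classes
with a limit point in `A`. -/
def IsLoebApprox (U : Ultrafilter I) (𝒜 : Set (Set X)) (μ : Set X → K) (p : I → Set (Set X))
    (A : Set X) (t : I → Set (Set X)) : Prop :=
  ∀ r : I → Set X, (∀ᶠ i in U, r i ∈ p i) →
    ((∀ᶠ i in U, r i ∈ t i) ↔ ∃ x ∈ A, IsLimitPoint U 𝒜 r x) ∨
      ∀ ε : ℝ, 0 < ε → ∀ᶠ i in U, ‖μ (r i)‖ < ε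

namespace IsRefiningPartition

variable {p : I → Set (Set X)}

theorem subset_or_subset_compl (hp : IsRefiningPartition U 𝒜 μ p)
    {r : I → Set X} (hr : ∀ᶠ i in U, r i ∈ p i) {A : Set X}
    (hA : A ∈ 𝒜) : (∀ᶠ i in U, r i ⊆ A) ∨ ∀ᶠ i in U, r i ⊆ Aᶜ :=
  Ultrafilter.eventually_or.1 <| by
    filter_upwards [hr, hp.refines A hA] with i h1 h2 using h2 _ h1

theorem eventually_nonempty (hp : IsRefiningPartition U 𝒜 μ p)
    {r : I → Set X} (hr : ∀ᶠ i in U, r i ∈ p i) :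
    ∀ᶠ i in U, (r i).Nonempty :=
  hr.mono fun i hi => nonempty_of_isPartition (hp.norming i).isPartition hi

theorem mem_iff_of_isLimitPoint (hp : IsRefiningPartition U 𝒜 μ p)
    (h𝒜 : MeasureTheory.IsSetAlgebra 𝒜) {r : I → Set X}
    (hr : ∀ᶠ i in U, r i ∈ p i) {x : X} (hx : IsLimitPoint U 𝒜 r x) {A : Set X} (hA : A ∈ 𝒜) :
    (∀ᶠ i in U, r i ⊆ A) ↔ x ∈ A := by
  refine ⟨fun h => by_contra fun hxA => ?_, hx A hA⟩
  obtain ⟨i, ⟨h1, h2⟩, y, hy⟩ := ((h.and (hx Aᶜ (h𝒜.compl_mem hA) hxA)).and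
    (hp.eventually_nonempty hr)).exists
  exact h2 hy (h1 hy)

theorem isLimitPoint_unique (hp : IsRefiningPartition U 𝒜 μ p)
    (h𝒜 : MeasureTheory.IsSetAlgebra 𝒜) (hμ : IsMeasureSpace 𝒜 μ)
    {r : I → Set X} (hr : ∀ᶠ i in U, r i ∈ p i) {x y : X} (hx : IsLimitPoint U 𝒜 r x)
    (hy : IsLimitPoint U 𝒜 r y) : x = y := by
  by_contra hne
  obtain ⟨A, hA, hxA, hyA⟩ := hμ.separating x trivial y trivial hne
  exact hyA ((hp.mem_iff_of_isLimitPoint h𝒜 hr hy hA).1 (hx A hA hxA))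

theorem eventually_norm_lt_of_subset (hp : IsRefiningPartition U 𝒜 μ p)
    (hμ : IsMeasureSpace 𝒜 μ) {r : I → Set X}
    (hr : ∀ᶠ i in U, r i ∈ p i) {A : Set X} (hA : A ∈ 𝒜) (hrA : ∀ᶠ i in U, r i ⊆ A) {ε : ℝ}
    (hε : setNorm 𝒜 μ A < ε) : ∀ᶠ i in U, ‖μ (r i)‖ < ε := by
  filter_upwards [hr, hrA] with i h1 h2
  exact (hμ.norm_le_setNorm hA ((hp.norming i).subset h1) h2).trans_lt hε

theorem eventually_norm_lt_of_weight_lt (hp : IsRefiningPartition U 𝒜 μ p)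
    (hμ : IsMeasureSpace 𝒜 μ) {r : I → Set X}
    (hr : ∀ᶠ i in U, r i ∈ p i) {x : X} (hx : IsLimitPoint U 𝒜 r x) {ε : ℝ}
    (hε : weight 𝒜 μ x < ε) : ∀ᶠ i in U, ‖μ (r i)‖ < ε := by
  obtain ⟨A, hA, hxA, hlt⟩ := hμ.exists_setNorm_lt (mem_univ x) hε
  exact hp.eventually_norm_lt_of_subset hμ hr hA (hx A hA hxA) hlt

/-- The standard sets containing the class are closed under intersection. As the class decides each
set of `𝒜`, a point common to all of them would be a limit point; so they have empty intersection
and contain sets of arbitrarily small norm. -/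
theorem eventually_norm_lt_of_forall_not (hp : IsRefiningPartition U 𝒜 μ p)
    (h𝒜 : MeasureTheory.IsSetAlgebra 𝒜)
    (hμ : IsMeasureSpace 𝒜 μ) {r : I → Set X} (hr : ∀ᶠ i in U, r i ∈ p i)
    (hx : ∀ x, ¬ IsLimitPoint U 𝒜 r x) {ε : ℝ} (hε : 0 < ε) : ∀ᶠ i in U, ‖μ (r i)‖ < ε := by
  obtain ⟨A, ⟨hA, hrA⟩, hlt⟩ := hμ.toIsContent.continuous_iff.1 hμ.continuous
    {A | A ∈ 𝒜 ∧ ∀ᶠ i in U, r i ⊆ A} (fun A hA => hA.1)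
    ⟨Set.univ, h𝒜.univ_mem, Eventually.of_forall fun i => subset_univ _⟩
    (fun A hA B hB => ⟨hμ.inter_mem hA.1 hB.1, by
      filter_upwards [hA.2, hB.2] with i h1 h2 using subset_inter h1 h2⟩)
    (eq_empty_iff_forall_notMem.2 fun x hxm => hx x fun A hA hxA => by
      rcases hp.subset_or_subset_compl hr hA with h | h
      · exact h
      · exact absurd hxA (hxm Aᶜ ⟨h𝒜.compl_mem hA, h⟩)) ε hε
  exact hp.eventually_norm_lt_of_subset hμ hr hA hrA hlt

/-- Smallness need only be checked for one internal class at a time: were the bound to fail at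
almost every index, choosing an offending class at each would give an internal counterexample. -/
theorem norm_sub_le_of_small (hp : IsRefiningPartition U 𝒜 μ p)
    [IsUltrametricDist K] (hμ : IsMeasureSpace 𝒜 μ)
    {t t' : I → Set (Set X)} (ht : ∀ᶠ i in U, t i ⊆ p i) (ht' : ∀ᶠ i in U, t' i ⊆ p i) {ε : ℝ}
    (hε : 0 ≤ ε) (h : ∀ r : I → Set X, (∀ᶠ i in U, r i ∈ p i) →
      (∀ᶠ i in U, r i ∈ t i ∆ t' i) → ∀ᶠ i in U, ‖μ (r i)‖ ≤ ε) :
    ∀ᶠ i in U, ‖μ (⋃₀ t i) - μ (⋃₀ t' i)‖ ≤ ε := by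
  have key : ∀ᶠ i in U, ∀ R ∈ t i ∆ t' i, ‖μ R‖ ≤ ε := by
    by_contra hc
    rw [← Ultrafilter.eventually_not] at hc
    push Not at hc
    obtain ⟨r, hr⟩ := hc.choice
    have hrp : ∀ᶠ i in U, r i ∈ p i := by
      filter_upwards [hr, ht, ht'] with i h1 h2 h3
      exact h1.1.elim (fun h => h2 h.1) fun h => h3 h.1
    obtain ⟨i, h1, h2⟩ := ((h r hrp (hr.mono fun i hi => hi.1)).and hr).exists
    exact h1.not_gt h2.2
  filter_upwards [ht, ht', key] with i h1 h2 h3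
  exact (hp.norming i).norm_meas_sUnion_sub_le hμ.toIsContent h1 h2 hε h3

/-- The classes contained in a standard set `B` are, up to classes of small measure, those with
limit point in `A`, if `A` and `B` differ only in points of small weight. -/
theorem iff_or_norm_lt (hp : IsRefiningPartition U 𝒜 μ p)
    (h𝒜 : MeasureTheory.IsSetAlgebra 𝒜) (hμ : IsMeasureSpace 𝒜 μ) {A B : Set X}
    (hB : B ∈ 𝒜) {ε ε' : ℝ} (hAB : ∀ x ∈ A ∆ B, weight 𝒜 μ x ≤ ε) (hε' : 0 < ε') (hε : ε < ε')
    {r : I → Set X} (hr : ∀ᶠ i in U, r i ∈ p i) :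
    ((∀ᶠ i in U, r i ∈ {R ∈ p i | R ⊆ B}) ↔ ∃ x ∈ A, IsLimitPoint U 𝒜 r x) ∨
      ∀ᶠ i in U, ‖μ (r i)‖ < ε' := by
  by_cases hx : ∃ x, IsLimitPoint U 𝒜 r x
  · obtain ⟨x, hx⟩ := hx
    have h1 : (∀ᶠ i in U, r i ∈ {R ∈ p i | R ⊆ B}) ↔ x ∈ B := by
      rw [← hp.mem_iff_of_isLimitPoint h𝒜 hr hx hB]
      exact eventually_congr (hr.mono fun i hi => and_iff_right hi)
    have h2 : (∃ x ∈ A, IsLimitPoint U 𝒜 r x) ↔ x ∈ A :=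
      ⟨fun ⟨y, hy, hry⟩ => hp.isLimitPoint_unique h𝒜 hμ hr hx hry ▸ hy, fun h => ⟨x, h, hx⟩⟩
    rw [h1, h2]
    by_cases h : x ∈ A ∆ B
    · exact Or.inr (hp.eventually_norm_lt_of_weight_lt hμ hr hx ((hAB x h).trans_lt hε))
    · rw [mem_symmDiff] at h
      tauto
  · exact Or.inr (hp.eventually_norm_lt_of_forall_not h𝒜 hμ hr (not_exists.1 hx) hε')

/-- The conditions on `t`, one for each `n`, say that `t` agrees with the classes inside `B n` up to
classes of measure below `2/(n+1)`. They are countably many, and finitely many of them are met by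
the classes inside `B m` for the largest index `m`. -/
theorem exists_isLoebApprox (hp : IsRefiningPartition U 𝒜 μ p)
    {κ : Cardinal.{u}} (hU : IsSaturated U κ) (hκ : ℵ₀ ≤ κ)
    (h𝒜 : MeasureTheory.IsSetAlgebra 𝒜) (hμ : IsMeasureSpace 𝒜 μ) {A : Set X}
    (hA : A ∈ extendedRing 𝒜 μ) :
    ∃ t : I → Set (Set X), (∀ᶠ i in U, t i ⊆ p i) ∧ IsLoebApprox U 𝒜 μ p A t := by
  have hpos : ∀ n : ℕ, 0 < 1 / ((n : ℝ) + 1) := fun n => Nat.one_div_pos_of_nat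
  choose B hB hAB using fun n : ℕ => hA _ (hpos n)
  -- The factor 2 leaves room between the weight bound, which is not strict, and the strict bound on
  -- the measure.
  have key : ∀ (n : ℕ) (r : I → Set X) (_ : ∀ᶠ i in U, r i ∈ p i),
      ((∀ᶠ i in U, r i ∈ {R ∈ p i | R ⊆ B n}) ↔ ∃ x ∈ A, IsLimitPoint U 𝒜 r x) ∨
      ∀ᶠ i in U, ‖μ (r i)‖ < 2 * (1 / ((n : ℝ) + 1)) := fun n r hr =>
    hp.iff_or_norm_lt h𝒜 hμ (hB n) (hAB n) (by linarith [hpos n]) (by linarith [hpos n]) hr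
  obtain ⟨t, ht⟩ := hU.exists_family (J := ULift.{u} ℕ) (by simpa using hκ)
    (fun n i => {T | T ⊆ p i ∧ ∀ R ∈ T ∆ {R ∈ p i | R ⊆ B n.down},
      ‖μ R‖ < 2 * (1 / ((n.down : ℝ) + 1))}) fun s => by
    have hmax : ∀ n ∈ s, n.down ≤ s.sup ULift.down := fun n hn => Finset.le_sup hn
    generalize s.sup ULift.down = m at hmax
    have hall : ∀ n ∈ s, ∀ᶠ i in U, ∀ R ∈ {R ∈ p i | R ⊆ B m} ∆ {R ∈ p i | R ⊆ B n.down},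
        ‖μ R‖ < 2 * (1 / ((n.down : ℝ) + 1)) := by
      intro n hn
      by_contra hc
      rw [← Ultrafilter.eventually_not] at hc
      push Not at hc
      obtain ⟨r, hr⟩ := hc.choice
      have hrp : ∀ᶠ i in U, r i ∈ p i := hr.mono fun i h => h.1.elim (fun h => h.1.1) fun h => h.1.1
      have hle : 2 * (1 / ((m : ℝ) + 1)) ≤ 2 * (1 / ((n.down : ℝ) + 1)) :=
        mul_le_mul_of_nonneg_left (Nat.one_div_le_one_div (hmax n hn)) two_pos.le
      have hbig : ¬ ∀ᶠ i in U, ‖μ (r i)‖ < 2 * (1 / ((n.down : ℝ) + 1)) := fun h => by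
        obtain ⟨i, h1, h2⟩ := (h.and hr).exists
        exact h1.not_ge h2.2
      -- Off the small classes, membership for `m` and for `n` is equivalent to the same condition
      -- on limit points, so `r` cannot lie in the symmetric difference.
      have h1 := (key m r hrp).resolve_right fun h => hbig (h.mono fun i hi => hi.trans_le hle)
      have h2 := (key n.down r hrp).resolve_right hbig
      have h3 := h1.trans h2.symm
      rcases Ultrafilter.eventually_or.1 (hr.mono fun i h => h.1) with h | h
      · obtain ⟨i, h4, h5⟩ := ((h3.1 (h.mono fun i h => h.1)).and h).exists
        exact h5.2 h4
      · obtain ⟨i, h4, h5⟩ := ((h3.2 (h.mono fun i h => h.1)).and h).exists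
        exact h5.2 h4
    filter_upwards [(eventually_all_finset s).2 hall] with i hi
    exact ⟨{R ∈ p i | R ⊆ B m}, fun n hn => ⟨fun R hR => hR.1, hi n hn⟩⟩
  refine ⟨t, (ht ⟨0⟩).mono fun i h => h.1, fun r hr => or_iff_not_imp_left.2 fun hne ε hε => ?_⟩
  obtain ⟨n, hn⟩ := exists_nat_one_div_lt (half_pos hε)
  have hn' : 2 * (1 / ((n : ℝ) + 1)) < ε := by linarith
  rcases eventually_iff_or_mem_symmDiff (U := U) r t (fun i => {R ∈ p i | R ⊆ B n}) with h | h
  · filter_upwards [h, ht ⟨n⟩] with i h1 h2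
    exact (h2.2 _ h1).trans hn'
  · rcases key n r hr with h' | h'
    · exact absurd (h.trans h') hne
    · exact h'.mono fun i hi => hi.trans hn'

theorem mem_extendedRing_of_isLoebApprox (hp : IsRefiningPartition U 𝒜 μ p)
    {κ : Cardinal.{u}} (hU : IsSaturated U κ)
    (h𝒜 : MeasureTheory.IsSetAlgebra 𝒜) (hμ : IsMeasureSpace 𝒜 μ) (h𝒜κ : #𝒜 ≤ κ) {A : Set X}
    {t : I → Set (Set X)} (ht : IsLoebApprox U 𝒜 μ p A t) : A ∈ extendedRing 𝒜 μ := by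
  classical
  intro ε₀ hε₀
  -- Halving pays for the factor 2 in the norming property: weight above `2 * ε` at a point forces
  -- its class to have measure at least `ε`.
  obtain ⟨ε, hε, rfl⟩ : ∃ ε : ℝ, 0 < ε ∧ ε₀ = 2 * ε := ⟨ε₀ / 2, half_pos hε₀, by ring⟩
  have hbig : ∀ r : I → Set X, (∀ᶠ i in U, r i ∈ p i) → (∀ᶠ i in U, ε ≤ ‖μ (r i)‖) →
      ¬ ∀ ε : ℝ, 0 < ε → ∀ᶠ i in U, ‖μ (r i)‖ < ε := fun r hr h h' => by
    obtain ⟨i, h1, h2⟩ := (h.and (h' ε hε)).exists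
    exact h1.not_gt h2
  -- `D B` and `N B` say that among the classes in `B` of measure at least `ε`, all, respectively
  -- none, belong to `t`.
  let D : Set X → Prop := fun B => ∀ᶠ i in U, ∀ R ∈ p i, R ⊆ B → ε ≤ ‖μ R‖ → R ∈ t i
  let N : Set X → Prop := fun B => ∀ᶠ i in U, ∀ R ∈ p i, R ⊆ B → ε ≤ ‖μ R‖ → R ∉ t i
  have hsat : ∀ (y : I → X) (Φ : I → Set X → Prop),
      (∀ B ∈ 𝒜, (∀ᶠ i in U, y i ∈ B) → ∀ᶠ i in U, ∃ R ∈ p i, R ⊆ B ∧ ε ≤ ‖μ R‖ ∧ Φ i R) →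
      ∃ r : I → Set X, (∀ᶠ i in U, r i ∈ p i) ∧ (∀ᶠ i in U, ε ≤ ‖μ (r i)‖) ∧
        (∀ᶠ i in U, Φ i (r i)) ∧ ∀ B ∈ 𝒜, (∀ᶠ i in U, y i ∈ B) → ∀ᶠ i in U, r i ⊆ B := by
    intro y Φ h
    obtain ⟨r, hr⟩ := hU.exists_family (J := {B // B ∈ 𝒜 ∧ ∀ᶠ i in U, y i ∈ B})
      ((mk_subtype_mono fun B hB => hB.1).trans h𝒜κ)
      (fun B i => {R | R ∈ p i ∧ R ⊆ (B : Set X) ∧ ε ≤ ‖μ R‖ ∧ Φ i R}) fun s => by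
        have hmem : (⋂ B ∈ s, (B : Set X)) ∈ 𝒜 := h𝒜.biInter_mem s fun B _ => B.2.1
        refine (h _ hmem ?_).mono ?_
        · simp only [mem_iInter]
          exact (eventually_all_finset s).2 fun B _ => B.2.2
        · rintro i ⟨R, hR, hRs, h1, h2⟩
          exact ⟨R, fun B hB => ⟨hR, hRs.trans (biInter_subset_of_mem hB), h1, h2⟩⟩
    have h0 := hr ⟨Set.univ, h𝒜.univ_mem, Eventually.of_forall fun i => mem_univ _⟩
    exact ⟨r, h0.mono fun i h => h.1, h0.mono fun i h => h.2.2.1, h0.mono fun i h => h.2.2.2,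
      fun B hB hy => (hr ⟨B, hB, hy⟩).mono fun i h => h.2.1⟩
  -- If no standard set around `y` is of type `D` or `N`, saturation yields two large classes, one
  -- in `t` and one not, both inside every standard set around `y`. The one in `t` has a limit point
  -- in `A`, which is then also a limit point of the other, contradicting the approximation.
  have hcover : ∀ y : I → X, ∃ B ∈ 𝒜, (D B ∨ N B) ∧ ∀ᶠ i in U, y i ∈ B := by
    intro y
    by_contra hc
    have hc' : ∀ B ∈ 𝒜, (∀ᶠ i in U, y i ∈ B) → ¬ D B ∧ ¬ N B := fun B hB hy =>
      not_or.1 fun h => hc ⟨B, hB, h, hy⟩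
    obtain ⟨r, hr, hrb, hrt, hry⟩ := hsat y (fun i R => R ∉ t i) fun B hB hy => by
      have := Ultrafilter.eventually_not.2 (hc' B hB hy).1
      push Not at this
      exact this
    obtain ⟨r', hr', hrb', hrt', hry'⟩ := hsat y (fun i R => R ∈ t i) fun B hB hy => by
      have := Ultrafilter.eventually_not.2 (hc' B hB hy).2
      push Not at this
      exact this
    obtain ⟨x, hxA, hx⟩ := ((ht r' hr').resolve_right (hbig r' hr' hrb')).1 hrt'
    have hxr : IsLimitPoint U 𝒜 r x := fun B hB hxB => by
      refine hry B hB ?_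
      by_contra hy
      have := hry' Bᶜ (h𝒜.compl_mem hB) (Ultrafilter.eventually_not.2 hy)
      exact (hp.mem_iff_of_isLimitPoint h𝒜 hr' hx (h𝒜.compl_mem hB)).1 this hxB
    obtain ⟨i, h1, h2⟩ :=
      (hrt.and (((ht r hr).resolve_right (hbig r hr hrb)).2 ⟨x, hxA, hxr⟩)).exists
    exact h1 h2
  -- Compactness: without a finite subcover, saturation would give an internal point outside all
  -- these sets, against `hcover`.
  obtain ⟨s, hs⟩ : ∃ s : Finset {B // B ∈ 𝒜 ∧ (D B ∨ N B)}, ∀ x : X, ∃ B ∈ s, x ∈ (B : Set X) := by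
    by_contra! hc
    obtain ⟨y, hy⟩ := hU.exists_family (J := {B // B ∈ 𝒜 ∧ (D B ∨ N B)})
      ((mk_subtype_mono fun B hB => hB.1).trans h𝒜κ) (fun B _ => (B : Set X)ᶜ) fun s =>
        Eventually.of_forall fun _ => hc s
    obtain ⟨B, hB, hDN, hyB⟩ := hcover y
    obtain ⟨i, h1, h2⟩ := ((hy ⟨B, hB, hDN⟩).and hyB).exists
    exact h1 h2
  refine ⟨⋃ B ∈ s.filter fun B : {B // B ∈ 𝒜 ∧ (D B ∨ N B)} => D B, (B : Set X), h𝒜.biUnion_mem _ fun B _ => B.2.1, ?_⟩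
  intro x hx
  by_contra! hlt
  -- The class of the standard point `x` has `x` as its limit point, and the norming property makes
  -- its measure at least `ε`.
  choose r hr hxr using fun i => exists_mem_of_isPartition (hp.norming i).isPartition x
  have hrp : ∀ᶠ i in U, r i ∈ p i := Eventually.of_forall hr
  have hrb : ∀ᶠ i in U, ε ≤ ‖μ (r i)‖ := Eventually.of_forall fun i => by
    have h1 := weight_le_setNorm (μ := μ) ((hp.norming i).subset (hr i)) (hxr i)
    have h2 := (hp.norming i).setNorm_le _ (hr i)
    linarith
  have hlim : IsLimitPoint U 𝒜 r x := fun B hB hxB => by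
    rcases hp.subset_or_subset_compl hrp hB with h | h
    · exact h
    · obtain ⟨i, hi⟩ := h.exists
      exact absurd hxB (hi (hxr i))
  have hiff : (∀ᶠ i in U, r i ∈ t i) ↔ x ∈ A := by
    rw [(ht r hrp).resolve_right (hbig r hrp hrb)]
    exact ⟨fun ⟨y, hy, hry⟩ => hp.isLimitPoint_unique h𝒜 hμ hrp hlim hry ▸ hy, fun h => ⟨x, h, hlim⟩⟩
  have hmem : ∀ B : {B // B ∈ 𝒜 ∧ (D B ∨ N B)}, x ∈ (B : Set X) → (D B ↔ x ∈ A) := fun B hxB => by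
    have hrB := hlim B B.2.1 hxB
    rw [← hiff]
    constructor
    · intro h
      filter_upwards [h, hrB, hrp, hrb] with i h1 h2 h3 h4 using h1 _ h3 h2 h4
    · intro h
      refine B.2.2.resolve_right fun hN => ?_
      obtain ⟨i, h1, h2⟩ := (h.and (hN.and (hrB.and (hrp.and hrb)))).exists
      exact h2.1 _ h2.2.2.1 h2.2.1 h2.2.2.2 h1
  rcases hx with ⟨hxA, hxB⟩ | ⟨hxB, hxA⟩
  · obtain ⟨B, hB, hxB'⟩ := hs x
    refine hxB (mem_iUnion₂.2 ⟨B, ?_, hxB'⟩)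
    rw [Finset.mem_filter]
    exact ⟨hB, (hmem B hxB').2 hxA⟩
  · obtain ⟨B, hB, hxB'⟩ := mem_iUnion₂.1 hxB
    exact hxA ((hmem B hxB').1 (Finset.mem_filter.1 hB).2)

end IsRefiningPartition

end Coordinates

/-! ### The Loeb space of the quotient and its push-down -/

section LoebSpace

variable {I : Type w} {U : Ultrafilter I}

theorem coe_mem_monad {α : Type*} [TopologicalSpace α] {f : I → α} {a : α} :
    (f : Star U α) ∈ monad U a ↔ Tendsto f U (nhds a) :=
  tendsto_nhds.symm

theorem coe_mem_monad_zero_iff {E : Type*} [SeminormedAddGroup E] {f : I → E} :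
    (f : Star U E) ∈ monad U (0 : E) ↔ ∀ ε : ℝ, 0 < ε → ∀ᶠ i in U, ‖f i‖ < ε := by
  rw [coe_mem_monad, NormedAddGroup.tendsto_nhds_zero]

variable {X : Type u} {K : Type v} [NontriviallyNormedField K] {𝒜 : Set (Set X)} {μ : Set X → K}

theorem coe_mem_monad_generateFrom {f : I → X} {x : X} :
    (f : Star U X) ∈ @monad I X (TopologicalSpace.generateFrom 𝒜) U x ↔
      ∀ A ∈ 𝒜, x ∈ A → ∀ᶠ i in U, f i ∈ A := by
  let := TopologicalSpace.generateFrom 𝒜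
  rw [coe_mem_monad, TopologicalSpace.tendsto_nhds_generateFrom_iff]
  rfl

/-- Monads of distinct points are disjoint because `𝒜` separates points and is closed under
complements, so the choice in `standardPart` is harmless. -/
theorem mem_standardPartOf_coe (h𝒜 : MeasureTheory.IsSetAlgebra 𝒜) (hμ : IsMeasureSpace 𝒜 μ)
    {f : I → X} {x : X} :
    x ∈ standardPartOf U 𝒜 (f : Star U X) ↔ ∀ A ∈ 𝒜, x ∈ A → ∀ᶠ i in U, f i ∈ A := by
  rw [← coe_mem_monad_generateFrom]
  constructor
  · rintro ⟨h, rfl⟩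
    exact Exists.choose_spec h
  · intro hx
    have h : ∃ a, (f : Star U X) ∈ @monad I X (TopologicalSpace.generateFrom 𝒜) U a := ⟨x, hx⟩
    refine ⟨h, ?_⟩
    change h.choose = x
    have hc := h.choose_spec
    rw [coe_mem_monad_generateFrom] at hc hx
    by_contra hne
    obtain ⟨A, hA, h1, h2⟩ := hμ.separating _ trivial _ trivial hne
    obtain ⟨i, h3, h4⟩ := ((hc A hA h1).and (hx Aᶜ (h𝒜.compl_mem hA) h2)).exists
    exact h4 h3

/-- The partial map sending a class to its limit point. -/
noncomputable def classLimit (U : Ultrafilter I) (𝒜 : Set (Set X)) (P : Star U (Set (Set X))) :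
    Star U (Set X) →. X :=
  fun R => ⟨R ∈ ext P ∧ ∃ x, ∃ r : I → Set X, (r : Star U (Set X)) = R ∧ IsLimitPoint U 𝒜 r x,
    fun h => h.2.choose⟩

theorem preimage_classLimit_subset (P : Star U (Set (Set X))) (A : Set X) :
    (classLimit U 𝒜 P).preimage A ⊆ ext P := by
  rintro R ⟨x, -, h, -⟩
  exact h.1

theorem isLimitPoint_congr {r r' : I → Set X} (h : (r : Star U (Set X)) = r') {x : X} :
    IsLimitPoint U 𝒜 r x ↔ IsLimitPoint U 𝒜 r' x := by
  rw [Germ.coe_eq] at h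
  refine forall₂_congr fun A _ => forall_congr' fun _ => eventually_congr ?_
  exact h.mono fun i hi => by rw [hi]

namespace IsRefiningPartition

variable {p : I → Set (Set X)}

theorem mem_classLimit_coe (hp : IsRefiningPartition U 𝒜 μ p)
    (h𝒜 : MeasureTheory.IsSetAlgebra 𝒜) (hμ : IsMeasureSpace 𝒜 μ)
    {r : I → Set X} {x : X} :
    x ∈ classLimit U 𝒜 (p : Star U (Set (Set X))) (r : Star U (Set X)) ↔
      (∀ᶠ i in U, r i ∈ p i) ∧ IsLimitPoint U 𝒜 r x := by
  have spec : ∀ h : (classLimit U 𝒜 (p : Star U (Set (Set X))) (r : Star U (Set X))).Dom,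
      IsLimitPoint U 𝒜 r (h.2.choose) := fun h => by
    obtain ⟨r', hr', hx⟩ := h.2.choose_spec
    exact (isLimitPoint_congr hr').1 hx
  constructor
  · rintro ⟨h, rfl⟩
    exact ⟨h.1, spec h⟩
  · rintro ⟨hr, hx⟩
    have h : (classLimit U 𝒜 (p : Star U (Set (Set X))) (r : Star U (Set X))).Dom :=
      ⟨hr, x, r, rfl, hx⟩
    exact ⟨h, hp.isLimitPoint_unique h𝒜 hμ hr (spec h) hx⟩

theorem coe_mem_preimage_classLimit (hp : IsRefiningPartition U 𝒜 μ p)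
    (h𝒜 : MeasureTheory.IsSetAlgebra 𝒜)
    (hμ : IsMeasureSpace 𝒜 μ) {r : I → Set X} (hr : ∀ᶠ i in U, r i ∈ p i) {A : Set X} :
    (r : Star U (Set X)) ∈ (classLimit U 𝒜 (p : Star U (Set (Set X)))).preimage A ↔
      ∃ x ∈ A, IsLimitPoint U 𝒜 r x := by
  rw [PFun.mem_preimage]
  simp only [hp.mem_classLimit_coe h𝒜 hμ, hr, true_and]

/-- As the class decides each standard set, one of its points lies in `*A` exactly when the whole
class does. -/
theorem classLimit_eq_standardPartOf (hp : IsRefiningPartition U 𝒜 μ p)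
    (h𝒜 : MeasureTheory.IsSetAlgebra 𝒜)
    (hμ : IsMeasureSpace 𝒜 μ) {R : Star U (Set X)} (hR : R ∈ ext (p : Star U (Set (Set X))))
    {y : Star U X} (hy : y ∈ ext R) :
    classLimit U 𝒜 (p : Star U (Set (Set X))) R = standardPartOf U 𝒜 y := by
  induction R using Germ.inductionOn with | h r => ?_
  induction y using Germ.inductionOn with | h f => ?_
  have hr : ∀ᶠ i in U, r i ∈ p i := hR
  have hf : ∀ᶠ i in U, f i ∈ r i := hy
  refine Part.ext fun x => ?_
  rw [hp.mem_classLimit_coe h𝒜 hμ, mem_standardPartOf_coe h𝒜 hμ, and_iff_right hr]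
  refine forall₂_congr fun A hA => forall_congr' fun _ => ⟨fun h => ?_, fun h => ?_⟩
  · filter_upwards [h, hf] with i h1 h2 using h1 h2
  · refine (hp.subset_or_subset_compl hr hA).resolve_right fun h' => ?_
    obtain ⟨i, h1, h2, h3⟩ := (h.and (h'.and hf)).exists
    exact h2 h3 h1

theorem isHyperfinitePartition (hp : IsRefiningPartition U 𝒜 μ p)
    : IsHyperfinitePartition 𝒜 (p : Star U (Set (Set X))) where
  hyperfinite := Eventually.of_forall fun i => (hp.norming i).finite
  subset R hR := by
    induction R using Germ.inductionOn with | h r => ?_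
    have hr : ∀ᶠ i in U, r i ∈ p i := hR
    exact hr.mono fun i hi => (hp.norming i).subset hi
  isPartition := by
    constructor
    · rintro ⟨R, hR, hempty⟩
      induction R using Germ.inductionOn with | h r => ?_
      obtain ⟨f, hf⟩ := (hp.eventually_nonempty (r := r) hR).choice
      have : (f : Star U X) ∈ ext (r : Star U (Set X)) := hf
      rw [hempty] at this
      exact this
    · intro y
      induction y using Germ.inductionOn with | h f => ?_
      choose r hr hfr using fun i => exists_mem_of_isPartition (hp.norming i).isPartition (f i)
      refine ⟨ext (r : Star U (Set X)), ⟨⟨_, ?_, rfl⟩, ?_⟩, ?_⟩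
      · exact Eventually.of_forall hr
      · exact Eventually.of_forall hfr
      · rintro _ ⟨⟨R, hR, rfl⟩, hfR⟩
        induction R using Germ.inductionOn with | h r' => ?_
        have hr' : ∀ᶠ i in U, r' i ∈ p i := hR
        have hfr' : ∀ᶠ i in U, f i ∈ r' i := hfR
        congr 1
        refine Germ.coe_eq.2 ?_
        filter_upwards [hr', hfr'] with i h1 h2
        exact eq_of_isPartition (hp.norming i).isPartition h1 (hr i) h2 (hfr i)

/-- The internal measure space of classes of a refining partition. -/
noncomputable def quotientSpace (hp : IsRefiningPartition U 𝒜 μ p)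
    (h𝒜 : MeasureTheory.IsSetAlgebra 𝒜) (hμ : IsMeasureSpace 𝒜 μ) :
    InternalMeasureSpace U (Set X) K :=
  ((fun i => (hp.norming i).contentSpace hμ.toIsContent h𝒜.univ_mem : I → ContentSpace (Set X) K) :
    Star U (ContentSpace (Set X) K))

variable (h𝒜 : MeasureTheory.IsSetAlgebra 𝒜) (hμ : IsMeasureSpace 𝒜 μ)

theorem coe_mem_quotientSpace_sets (hp : IsRefiningPartition U 𝒜 μ p) {t : I → Set (Set X)} :
    (t : Star U (Set (Set X))) ∈ ext (hp.quotientSpace h𝒜 hμ).sets ↔ ∀ᶠ i in U, t i ⊆ p i :=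
  Iff.rfl

theorem quotientSpace_meas_coe (hp : IsRefiningPartition U 𝒜 μ p) (t : I → Set (Set X)) :
    (hp.quotientSpace h𝒜 hμ).meas (t : Star U (Set (Set X))) =
      ((fun i => μ (⋃₀ t i) : I → K) : Star U K) := rfl

theorem loebNull_quotientSpace_iff (hp : IsRefiningPartition U 𝒜 μ p) {E : Set (Star U (Set X))} :
    (hp.quotientSpace h𝒜 hμ).LoebNull E ↔ E ⊆ ext (p : Star U (Set (Set X))) ∧
      ∀ r : I → Set X, (r : Star U (Set X)) ∈ E → ∀ ε : ℝ, 0 < ε → ∀ᶠ i in U, ‖μ (r i)‖ < ε := by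
  refine and_congr_right fun hE => ?_
  have key : ∀ r : I → Set X, (r : Star U (Set X)) ∈ E →
      ((hp.quotientSpace h𝒜 hμ).weight (r : Star U (Set X)) ∈ monad U (0 : ℝ) ↔
        ∀ ε : ℝ, 0 < ε → ∀ᶠ i in U, ‖μ (r i)‖ < ε) := fun r hr => by
    have hrp : ∀ᶠ i in U, r i ∈ p i := hE hr
    have heq : (hp.quotientSpace h𝒜 hμ).weight (r : Star U (Set X)) =
        ((fun i => ‖μ (r i)‖ : I → ℝ) : Star U ℝ) :=
      Germ.coe_eq.2 <| hrp.mono fun i hi =>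
        (hp.norming i).weight_eq hμ.toIsContent h𝒜.univ_mem hi
    rw [heq, coe_mem_monad_zero_iff]
    simp only [norm_norm]
  constructor
  · intro h r hr
    exact (key r hr).1 (h _ hr)
  · intro h R hR
    induction R using Germ.inductionOn with | h r => ?_
    exact (key r hR).2 (h r hR)

/-- Translates Loeb approximation of `st_Y⁻¹(A)` into the statement about representatives proved
above. -/
theorem loebNull_symmDiff_iff (hp : IsRefiningPartition U 𝒜 μ p)
    {A : Set X} {t : I → Set (Set X)} (ht : ∀ᶠ i in U, t i ⊆ p i) :
    (hp.quotientSpace h𝒜 hμ).LoebNull ((classLimit U 𝒜 (p : Star U (Set (Set X)))).preimage A ∆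
      ext (t : Star U (Set (Set X)))) ↔ IsLoebApprox U 𝒜 μ p A t := by
  have hsub : (classLimit U 𝒜 (p : Star U (Set (Set X)))).preimage A ∆
      ext (t : Star U (Set (Set X))) ⊆ ext (p : Star U (Set (Set X))) := by
    rintro R (⟨h, -⟩ | ⟨h, -⟩)
    · exact preimage_classLimit_subset _ A h
    · induction R using Germ.inductionOn with | h r => ?_
      have h' : ∀ᶠ i in U, r i ∈ t i := h
      change ∀ᶠ i in U, r i ∈ p i
      filter_upwards [h', ht] with i h1 h2 using h2 h1
  rw [hp.loebNull_quotientSpace_iff, and_iff_right hsub]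
  have key : ∀ r : I → Set X, (∀ᶠ i in U, r i ∈ p i) →
      ((r : Star U (Set X)) ∈ (classLimit U 𝒜 (p : Star U (Set (Set X)))).preimage A ∆
        ext (t : Star U (Set (Set X))) ↔
      ¬ ((∀ᶠ i in U, r i ∈ t i) ↔ ∃ x ∈ A, IsLimitPoint U 𝒜 r x)) := fun r hr => by
    have h : (r : Star U (Set X)) ∈ ext (t : Star U (Set (Set X))) ↔ ∀ᶠ i in U, r i ∈ t i := Iff.rfl
    rw [mem_symmDiff, hp.coe_mem_preimage_classLimit h𝒜 hμ hr, h, not_iff]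
    by_cases ht : ∀ᶠ i in U, r i ∈ t i <;> simp only [ht, true_and, false_and, not_true,
      not_false_eq_true, and_true, and_false, or_false, false_or, false_iff, true_iff]
  constructor
  · intro h r hr
    exact or_iff_not_imp_left.2 fun hne => h r ((key r hr).2 hne)
  · intro h r hr
    exact (h r (hsub hr)).resolve_left ((key r (hsub hr)).1 hr)

theorem preimage_mem_loebSets_iff (hp : IsRefiningPartition U 𝒜 μ p)
    {κ : Cardinal.{u}} (hU : IsSaturated U κ) (hκ : ℵ₀ ≤ κ)
    (h𝒜κ : #𝒜 ≤ κ) (A : Set X) :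
    A ∈ extendedRing 𝒜 μ ↔ (classLimit U 𝒜 (p : Star U (Set (Set X)))).preimage A ∈
      (hp.quotientSpace h𝒜 hμ).loebSets := by
  constructor
  · intro hA
    obtain ⟨t, ht, hAt⟩ := hp.exists_isLoebApprox hU hκ h𝒜 hμ hA
    exact ⟨preimage_classLimit_subset _ A, t, ht, (hp.loebNull_symmDiff_iff h𝒜 hμ ht).2 hAt⟩
  · rintro ⟨-, T, hT, hAT⟩
    induction T using Germ.inductionOn with | h t => ?_
    exact hp.mem_extendedRing_of_isLoebApprox hU h𝒜 hμ h𝒜κ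
      ((hp.loebNull_symmDiff_iff h𝒜 hμ hT).1 hAT)

theorem exists_hasLoebMeasure (hp : IsRefiningPartition U 𝒜 μ p) [IsUltrametricDist K]
    (hdom : ∀ T ∈ ext (hp.quotientSpace h𝒜 hμ).sets,
      (standardPart U K ((hp.quotientSpace h𝒜 hμ).meas T)).Dom)
    {E : Set (Star U (Set X))} (hE : E ∈ (hp.quotientSpace h𝒜 hμ).loebSets) :
    ∃ c : K, (hp.quotientSpace h𝒜 hμ).HasLoebMeasure E c := by
  obtain ⟨T, hT, hET⟩ := hE.2
  obtain ⟨c, hc⟩ := hdom T hT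
  refine ⟨c, hE, fun T' hT' hET' => ?_⟩
  rw [hp.loebNull_quotientSpace_iff] at hET hET'
  induction T using Germ.inductionOn with | h t => ?_
  induction T' using Germ.inductionOn with | h t' => ?_
  rw [hp.quotientSpace_meas_coe, coe_mem_monad] at hc ⊢
  have hdiff : Tendsto (fun i => μ (⋃₀ t' i) - μ (⋃₀ t i)) U (nhds 0) := by
    rw [NormedAddGroup.tendsto_nhds_zero]
    intro ε hε
    refine (hp.norm_sub_le_of_small hμ hT' hT (half_pos hε).le fun r hr hrt => ?_).mono
      fun i hi => hi.trans_lt (half_lt_self hε)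
    -- A class on which the two approximants disagree lies in the symmetric difference of `E` with
    -- one of them, hence has infinitesimal measure.
    have hmem : (r : Star U (Set X)) ∈ E ∆ ext (t : Star U (Set (Set X))) ∨
        (r : Star U (Set X)) ∈ E ∆ ext (t' : Star U (Set (Set X))) := by
      have h1 : (r : Star U (Set X)) ∈ ext (t : Star U (Set (Set X))) ↔ ∀ᶠ i in U, r i ∈ t i :=
        Iff.rfl
      have h2 : (r : Star U (Set X)) ∈ ext (t' : Star U (Set (Set X))) ↔ ∀ᶠ i in U, r i ∈ t' i :=
        Iff.rfl
      have h3 : (∀ᶠ i in U, r i ∈ t' i ∧ r i ∉ t i) ∨ ∀ᶠ i in U, r i ∈ t i ∧ r i ∉ t' i :=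
        Ultrafilter.eventually_or.1 hrt
      simp only [eventually_and, Ultrafilter.eventually_not] at h3
      rw [mem_symmDiff, mem_symmDiff, h1, h2]
      tauto
    rcases hmem with h | h
    · exact (hET.2 r h _ (half_pos hε)).mono fun i hi => hi.le
    · exact (hET'.2 r h _ (half_pos hε)).mono fun i hi => hi.le
  simpa using hdiff.add hc

theorem hasExtendedMeasure_of_hasLoebMeasure (hp : IsRefiningPartition U 𝒜 μ p)
    [IsUltrametricDist K] {A : Set X}
    (hA : A ∈ extendedRing 𝒜 μ) {c : K} (hc : (hp.quotientSpace h𝒜 hμ).HasLoebMeasure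
      ((classLimit U 𝒜 (p : Star U (Set (Set X)))).preimage A) c) :
    HasExtendedMeasure 𝒜 μ A c := by
  obtain ⟨⟨-, T, hT, hAT⟩, hmeas⟩ := hc
  induction T using Germ.inductionOn with | h t => ?_
  have hlim := hmeas _ hT hAT
  have happrox := (hp.loebNull_symmDiff_iff h𝒜 hμ hT).1 hAT
  rw [hp.quotientSpace_meas_coe, coe_mem_monad, Metric.tendsto_nhds] at hlim
  -- Weights at most `δ / 4` lie strictly below the threshold `δ / 2` for classes; a second `δ / 2`
  -- bounds the distance from the measure of `t` to `c`.
  refine ⟨hA, fun δ hδ => ⟨δ / 4, by positivity, fun B hB hAB => ?_⟩⟩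
  have hclose := hp.norm_sub_le_of_small hμ (t := fun i => {R ∈ p i | R ⊆ B}) (t' := t)
    (Eventually.of_forall fun i R hR => hR.1) hT (half_pos hδ).le fun r hr hrt => by
      rcases hp.iff_or_norm_lt h𝒜 hμ hB hAB (half_pos hδ) (by linarith) hr with h | h
      · rcases happrox r hr with h' | h'
        · have h3 : (∀ᶠ i in U, r i ∈ {R ∈ p i | R ⊆ B} ∧ r i ∉ t i) ∨
              ∀ᶠ i in U, r i ∈ t i ∧ r i ∉ {R ∈ p i | R ⊆ B} := Ultrafilter.eventually_or.1 hrt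
          have h4 := h.trans h'.symm
          rcases h3 with h3 | h3
          · obtain ⟨i, h5, h6⟩ := ((h4.1 (h3.mono fun i h => h.1)).and h3).exists
            exact absurd h5 h6.2
          · obtain ⟨i, h5, h6⟩ := ((h4.2 (h3.mono fun i h => h.1)).and h3).exists
            exact absurd h5 h6.2
        · exact (h' _ (half_pos hδ)).mono fun i hi => hi.le
      · exact h.mono fun i hi => hi.le
  -- At an index where the partition refines `B`, the classes inside `B` have union exactly `B`, so
  -- `μ B` can be compared with the measure of `t`.
  obtain ⟨i, h1, h2, h3⟩ := (hclose.and ((hp.refines B hB).and (hlim _ (half_pos hδ)))).exists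
  rw [(hp.norming i).sUnion_subset_eq h2] at h1
  rw [dist_eq_norm] at h3
  linarith [norm_sub_le_norm_sub_add_norm_sub (μ B) (μ (⋃₀ t i)) c]

end IsRefiningPartition

end LoebSpace

end NonArchLoeb

open NonArchLoeb in
theorem mainTheorem1 {I : Type w} (U : Ultrafilter I) {X : Type u} {K : Type v}
    [NontriviallyNormedField K] [IsUltrametricDist K] [CompleteSpace K]
    (𝒜 : Set (Set X)) (μ : Set X → K)
    (h𝒜 : MeasureTheory.IsSetAlgebra 𝒜) (hμ : IsMeasureSpace 𝒜 μ)
    (κ : Cardinal.{u}) (hκ : ℵ₀ ≤ κ) (h𝒜κ : #𝒜 ≤ κ) (hU : IsSaturated U κ)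
    (hns : ∀ B ∈ ext (𝒜 : Star U (Set (Set X))), (standardPart U K (Germ.map μ B)).Dom) :
    ∃ P : Star U (Set (Set X)), IsHyperfinitePartition 𝒜 P ∧
    ∃ Y : InternalMeasureSpace U (Set X) K,
      -- the points of `Y` are the classes of the partition, and `ν` is induced by `*μ`
      Y.carrier = P ∧
      (∀ T : Star U (Set (Set X)), ext T ⊆ ext P → T ∈ ext Y.sets) ∧
      (∀ T ∈ ext Y.sets, Y.meas T = Germ.map μ (Germ.map Set.sUnion T)) ∧
      -- the Loeb space of `Y` is defined
      (∀ T ∈ ext Y.sets, (standardPart U K (Y.meas T)).Dom) ∧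
      (∃ C : ℝ, ∀ T ∈ ext Y.sets, Germ.LiftPred (fun k : K => ‖k‖ ≤ C) (Y.meas T)) ∧
      (∀ E ∈ Y.loebSets, ∃ c : K, Y.HasLoebMeasure E c) ∧
      -- `st_X` factors through a partial map `st_Y`, which is defined almost everywhere
      ∃ stY : Star U (Set X) →. X,
        stY.Dom ⊆ ext P ∧
        (∀ R ∈ ext P, ∀ y ∈ ext R, stY R = standardPartOf U 𝒜 y) ∧
        Y.LoebNull (ext P \ stY.Dom) ∧
        -- the extended space is the push-down of the Loeb space
        (∀ A : Set X, A ∈ extendedRing 𝒜 μ ↔ stY.preimage A ∈ Y.loebSets) ∧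
        (∀ A ∈ extendedRing 𝒜 μ, ∃ c : K,
          HasExtendedMeasure 𝒜 μ A c ∧ Y.HasLoebMeasure (stY.preimage A) c) := by
  obtain ⟨p, hp⟩ := exists_isRefiningPartition hU h𝒜 hμ h𝒜κ
  have hsUnion : ∀ t : I → Set (Set X), (∀ᶠ i in U, t i ⊆ p i) → ∀ᶠ i in U, ⋃₀ t i ∈ 𝒜 :=
    fun t ht => ht.mono fun i hi => (hp.norming i).sUnion_mem hμ.toIsContent hi
  have hdom : ∀ T ∈ ext (hp.quotientSpace h𝒜 hμ).sets,
      (standardPart U K ((hp.quotientSpace h𝒜 hμ).meas T)).Dom := fun T hT => by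
    induction T using Germ.inductionOn with | h t => ?_
    exact hns ((fun i => ⋃₀ t i : I → Set X) : Star U (Set X)) (hsUnion t hT)
  refine ⟨(p : Star U (Set (Set X))), hp.isHyperfinitePartition, hp.quotientSpace h𝒜 hμ, rfl,
    fun T hT => ?_, fun T hT => ?_, hdom, ⟨setNorm 𝒜 μ Set.univ, fun T hT => ?_⟩,
    fun E hE => hp.exists_hasLoebMeasure h𝒜 hμ hdom hE, classLimit U 𝒜 (p : Star U (Set (Set X))),
    fun R hR => ?_, fun R hR y hy => hp.classLimit_eq_standardPartOf h𝒜 hμ hR hy, ?_,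
    hp.preimage_mem_loebSets_iff h𝒜 hμ hU hκ h𝒜κ, fun A hA => ?_⟩
  · induction T using Germ.inductionOn with | h t => ?_
    rw [hp.coe_mem_quotientSpace_sets]
    -- If `t` were not internally a set of classes, choosing a stray member at almost every index
    -- would give an element of `ext T` outside `ext P`.
    by_contra hc
    rw [← Ultrafilter.eventually_not] at hc
    simp only [not_subset] at hc
    obtain ⟨r, hr⟩ := hc.choice
    have hrp : ∀ᶠ i in U, r i ∈ p i :=
      hT (show (r : Star U (Set X)) ∈ ext (t : Star U (Set (Set X))) from hr.mono fun i h => h.1)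
    obtain ⟨i, h1, h2⟩ := (hr.and hrp).exists
    exact h1.2 h2
  · induction T using Germ.inductionOn with | h t => ?_
    rfl
  · induction T using Germ.inductionOn with | h t => ?_
    exact (hsUnion t hT).mono fun i hi =>
      hμ.norm_le_setNorm h𝒜.univ_mem hi (subset_univ _)
  · obtain ⟨h, -⟩ := hR
    exact h
  · rw [hp.loebNull_quotientSpace_iff]
    refine ⟨sdiff_subset, fun r hr ε hε => ?_⟩
    exact hp.eventually_norm_lt_of_forall_not h𝒜 hμ hr.1
      (fun x hx => hr.2 ⟨hr.1, x, r, rfl, hx⟩) hε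
  · obtain ⟨c, hc⟩ := hp.exists_hasLoebMeasure h𝒜 hμ hdom
      ((hp.preimage_mem_loebSets_iff h𝒜 hμ hU hκ h𝒜κ A).1 hA)
    exact ⟨c, hp.hasExtendedMeasure_of_hasLoebMeasure h𝒜 hμ hA hc, hc⟩
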